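/- Let $\mathbb{R}^{n\times m}$ ($n\le m$) be the space of real $n\times m$ matrices and $\mathbb{S}^n$ the space of real symmetric $n\times n$ matrices, both with the trace inner product $\langle A,B\rangle=\operatorname{tr}(A^{\mathsf T}B)$ and the Frobenius norm, and let $\mathbb{X}$ be $\mathbb{R}^{n\times m}$ or $\mathbb{S}^n$. For a subset $S$ of such a space $\mathbb{E}$ define: - the regular normal cone $\widehat{\mathcal N}_S(x)=\{v\in\mathbb{E}:\limsup_{y\to x,\,y\in S,\,y\ne x}\langle v,y-x\rangle/\|y-x\|\le 0\}$ for $x\in S$, and $\widehat{\mathcal N}_S(x)=\emptyset$ for $x\notin S$; - the limiting normal cone $\mathcal N_S(x)$ at $x\in S$: all $v$ for which there are $x^k\to x$ with $x^k\in S$ and $v^k\to v$ with $v^k\in\widehat{\mathcal N}_S(x^k)$ for all $k$; - the tangent cone $\mathcal T_S(x)$ at $x\in S$: all $u$ for which there are $u^k\to u$ and $t_k>0$, $t_k\to0$, with $x+t_ku^k\in S$ for all $k$; - the limiting normal cone in direction $d$, $\mathcal N_S(x;d)$, at $x\in S$: all $v$ for which there are $t_k>0$, $t_k\to0$, $d^k\to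 d$ and $v^k\to v$ with $v^k\in\widehat{\mathcal N}_S(x+t_kd^k)$ for all $k$; - the inner limiting normal cone in direction $d$, $\mathcal N^i_S(x;d)$, at $x\in S$: all $v$ such that for every sequence $t_k>0$, $t_k\to0$, there are $d^k\to d$ and $v^k\to v$ with $v^k\in\widehat{\mathcal N}_S(x+t_kd^k)$ for all $k$. Fix $r\in\{1,\dots,n\}$ and put $\Lambda_r=\{X\in\mathbb{X}:\operatorname{rank}X\le r\}$ and $\Lambda_r^+=\{X\in\mathbb{S}^n: X\text{ positive semidefinite},\ \operatorname{rank}X\le r\}$, where cones of $\Lambda_r$ are taken in $\mathbb{X}$ and cones of $\Lambda_r^+$ in $\mathbb{S}^n$. **Proposition 2.1.** For every $X\in\Lambda_r^+$ with $\operatorname{rank}X=r$, $$\mathcal N^i_{\Lambda_r^+}(X;H)=\mathcal N_{\Lambda_r^+}(X;H)=\mathcal N_{\Lambda_r^+}(X)\quad\text{for all }H\in\mathcal T_{\Lambda_r^+}(X).$$ Likewise, for every $X\in\Lambda_r$ with $\operatorname{rank}X=r$ (both for $\mathbb{X}=\mathbb{R}^{n\times m}$ and for $\mathbb{X}=\mathbb{S}^n$),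 $$\mathcal N^i_{\Lambda_r}(X;H)=\mathcal N_{\Lambda_r}(X;H)=\mathcal N_{\Lambda_r}(X)\quad\text{for all }H\in\mathcal T_{\Lambda_r}(X).$$ -/

import Mathlib

open Filter Topology

/-! ### Tangent and normal cones in a real inner product space -/

section Cones

variable {E : Type*} [NormedAddCommGroup E] [InnerProductSpace ℝ E]

/-- The Fréchet (regular) normal cone to `S` at `x`: the vectors `v` with
`limsup ⟪v, y - x⟫ / ‖y - x‖ ≤ 0` as `y → x` with `y ∈ S` and `y ≠ x`. The upper limit is taken
in the extended reals, so it is `-∞` at an isolated point of `S`. The cone is empty at points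
outside `S`. -/
def frechetNormalCone (S : Set E) (x : E) : Set E :=
  {v | x ∈ S ∧
    limsup (fun y : E => ((inner ℝ v (y - x) / ‖y - x‖ : ℝ) : EReal)) (𝓝[S \ {x}] x) ≤ 0}

/-- The limiting (Mordukhovich) normal cone to `S` at `x`. -/
def limitingNormalCone (S : Set E) (x : E) : Set E :=
  {v | ∃ (y w : ℕ → E), (∀ k, y k ∈ S) ∧ Tendsto y atTop (𝓝 x) ∧ Tendsto w atTop (𝓝 v) ∧
    ∀ k, w k ∈ frechetNormalCone S (y k)}

/-- The tangent (Bouligand, contingent) cone to `S` at `x`. -/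
def bouligandTangentCone (S : Set E) (x : E) : Set E :=
  {u | ∃ (w : ℕ → E) (t : ℕ → ℝ), Tendsto w atTop (𝓝 u) ∧ (∀ k, 0 < t k) ∧
    Tendsto t atTop (𝓝 0) ∧ ∀ k, x + t k • w k ∈ S}

/-- The limiting normal cone to `S` at `z` in direction `d`. -/
def directionalNormalCone (S : Set E) (z d : E) : Set E :=
  {v | ∃ t : ℕ → ℝ, (∀ k, 0 < t k) ∧ Tendsto t atTop (𝓝 0) ∧
    ∃ (e w : ℕ → E), Tendsto e atTop (𝓝 d) ∧ Tendsto w atTop (𝓝 v) ∧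
      ∀ k, w k ∈ frechetNormalCone S (z + t k • e k)}

/-- The inner limiting normal cone to `S` at `z` in direction `d`: for every sequence of step
sizes `t k ↓ 0` there are directions `e k → d` and regular normals `w k → v`. -/
def innerDirectionalNormalCone (S : Set E) (z d : E) : Set E :=
  {v | ∀ t : ℕ → ℝ, (∀ k, 0 < t k) → Tendsto t atTop (𝓝 0) →
    ∃ (e w : ℕ → E), Tendsto e atTop (𝓝 d) ∧ Tendsto w atTop (𝓝 v) ∧
      ∀ k, w k ∈ frechetNormalCone S (z + t k • e k)}

end Cones

/-! ### The matrix spaces with the trace inner product and the Frobenius norm -/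

attribute [local instance] Matrix.frobeniusNormedAddCommGroup Matrix.frobeniusNormedSpace

/-- The trace inner product `⟪A, B⟫ = tr (Aᵀ B)`, which induces the Frobenius norm. -/
noncomputable instance matrixInnerProductSpace (n m : ℕ) :
    InnerProductSpace ℝ (Matrix (Fin n) (Fin m) ℝ) where
  inner A B := (A.transpose * B).trace
  norm_sq_eq_re_inner A := by
    have h : 0 ≤ ∑ i, ∑ j, ‖A i j‖ ^ (2 : ℝ) := by positivity
    rw [Matrix.frobenius_norm_def, ← Real.sqrt_eq_rpow, Real.sq_sqrt h]
    simp only [Matrix.trace, Matrix.diag, Matrix.mul_apply, Matrix.transpose_apply,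
      RCLike.re_to_real]
    rw [Finset.sum_comm]
    refine Finset.sum_congr rfl fun i _ => Finset.sum_congr rfl fun j _ => ?_
    rw [Real.rpow_two, Real.norm_eq_abs, sq_abs, sq]
  conj_inner_symm A B := by
    simp only [conj_trivial]
    rw [← Matrix.trace_transpose, Matrix.transpose_mul, Matrix.transpose_transpose]
  add_left A B C := by
    simp [Matrix.transpose_add, Matrix.add_mul, Matrix.trace_add]
  smul_left A B c := by
    simp [Matrix.transpose_smul, Matrix.trace_smul]

/-- The space of real symmetric `n × n` matrices, a subspace of the space of all matrices
(with the induced inner product). -/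
def symMatrix (n : ℕ) : Submodule ℝ (Matrix (Fin n) (Fin n) ℝ) where
  carrier := {A | A.IsSymm}
  add_mem' hA hB := hA.add hB
  zero_mem' := Matrix.isSymm_zero
  smul_mem' c _ hA := hA.smul c

/-! ### The rank constraint sets -/

/-- The real `n × m` matrices of rank at most `r`. -/
def rankSet (n m r : ℕ) : Set (Matrix (Fin n) (Fin m) ℝ) :=
  {X | X.rank ≤ r}

/-- The real symmetric `n × n` matrices of rank at most `r`, as a subset of the space of
symmetric matrices. -/
def symRankSet (n r : ℕ) : Set (symMatrix n) :=
  {X | X.1.rank ≤ r}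

/-- The positive semidefinite `n × n` matrices of rank at most `r`, as a subset of the space of
symmetric matrices. -/
def psdRankSet (n r : ℕ) : Set (symMatrix n) :=
  {X | X.1.PosSemidef ∧ X.1.rank ≤ r}

/-! ### General facts on normal cones -/

section Cones

variable {E : Type*} [NormedAddCommGroup E] [InnerProductSpace ℝ E]

/-! Each set is invariant under a matrix action: `X ↦ P X Q` for `rankSet`, the congruence `X ↦ P X
Pᵀ` for the two symmetric sets. Near a matrix of rank exactly `r` the first action by matrices near
`1` reaches every point of `rankSet` (`exists_local_factorization`), so tangents have the form `A X
+ X B` and the regular normals at `X` form the linear space `K` given by `Vᵀ X = 0`, `X Vᵀ = 0`.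

Inner normals are directional and directional normals are limiting, so it suffices that limiting
normals lie in `K` and `K` lies in the inner cone (`normalCones_eq`). Regular normals satisfy the
equations of `K` at points of any rank, by invariance alone, and these equations pass to limits.
Conversely, for `H = A X + X B` the curve `(1 + t A) X (1 + t B)` has velocity `H` and keeps rank
`r`, and `V` is carried along it by the inverse transposes. The curve serves every sequence of step
sizes, which gives inner normals. In the symmetric case `B = Aᵀ`. -/

theorem mem_frechetNormalCone_iff {S : Set E} {x v : E} :
    v ∈ frechetNormalCone S x ↔ x ∈ S ∧
      ∀ ε : ℝ, 0 < ε → ∀ᶠ y in 𝓝[S] x, inner ℝ v (y - x) ≤ ε * ‖y - x‖ := by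
  refine and_congr_right fun hx => ⟨fun h ε hε => ?_, fun h => ?_⟩
  · have h1 := eventually_lt_of_limsup_lt (h.trans_lt (EReal.coe_pos.2 hε))
    rw [eventually_nhdsWithin_iff] at h1 ⊢
    filter_upwards [h1] with y hy hyS
    rcases eq_or_ne y x with rfl | hne
    · simp
    · have h2 := EReal.coe_lt_coe_iff.1 (hy ⟨hyS, hne⟩)
      have h3 : 0 < ‖y - x‖ := norm_pos_iff.2 (sub_ne_zero.2 hne)
      exact ((div_lt_iff₀ h3).1 h2).le
  · refine EReal.le_of_forall_lt_iff_le.1 fun ε hε => ?_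
    have hε' : 0 < ε := EReal.coe_pos.1 hε
    refine limsup_le_of_le (by isBoundedDefault) ?_
    have h1 := h ε hε'
    rw [eventually_nhdsWithin_iff] at h1 ⊢
    filter_upwards [h1] with y hy hyS
    have h3 : 0 < ‖y - x‖ := norm_pos_iff.2 (sub_ne_zero.2 hyS.2)
    exact EReal.coe_le_coe_iff.2 ((div_le_iff₀ h3).2 (hy hyS.1))

/-- A regular normal makes a nonpositive product with the velocity of a quadratic curve in `S`. -/
theorem inner_nonpos_of_mem_frechetNormalCone {S : Set E} {x v u w : E}
    (hv : v ∈ frechetNormalCone S x) (h : ∀ t : ℝ, x + (t • u + t ^ 2 • w) ∈ S) :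
    inner ℝ v u ≤ 0 := by
  have key : ∀ ε : ℝ, 0 < ε → inner ℝ v u ≤ ε * ‖u‖ := by
    intro ε hε
    have h1 := (mem_frechetNormalCone_iff.1 hv).2 ε hε
    have hγ : Tendsto (fun t : ℝ => x + (t • u + t ^ 2 • w)) (𝓝[>] 0) (𝓝[S] x) := by
      refine tendsto_nhdsWithin_iff.2 ⟨?_, Eventually.of_forall h⟩
      refine (Continuous.tendsto' ?_ _ _ (by simp)).mono_left nhdsWithin_le_nhds
      fun_prop
    have hl : Tendsto (fun t : ℝ => inner ℝ v (u + t • w)) (𝓝[>] 0) (𝓝 (inner ℝ v u)) := by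
      refine (Continuous.tendsto' ?_ _ _ (by simp)).mono_left nhdsWithin_le_nhds
      fun_prop
    have hr : Tendsto (fun t : ℝ => ε * ‖u + t • w‖) (𝓝[>] 0) (𝓝 (ε * ‖u‖)) := by
      refine (Continuous.tendsto' ?_ _ _ (by simp)).mono_left nhdsWithin_le_nhds
      fun_prop
    refine le_of_tendsto_of_tendsto hl hr ?_
    filter_upwards [hγ.eventually h1, self_mem_nhdsWithin] with t ht htpos
    have htpos : 0 < t := htpos
    have e : x + (t • u + t ^ 2 • w) - x = t • (u + t • w) := by
      rw [add_sub_cancel_left, smul_add, smul_smul, sq]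
    rw [e, inner_smul_right, norm_smul, Real.norm_of_nonneg htpos.le, mul_left_comm] at ht
    exact le_of_mul_le_mul_left ht htpos
  refine le_of_forall_pos_le_add fun δ hδ => ?_
  have h1 := key (δ / (‖u‖ + 1)) (by positivity)
  refine h1.trans ?_
  rw [zero_add, div_mul_eq_mul_div, div_le_iff₀ (by positivity)]
  nlinarith [norm_nonneg u]

theorem innerDirectionalNormalCone_subset (S : Set E) (x d : E) :
    innerDirectionalNormalCone S x d ⊆ directionalNormalCone S x d := by
  intro v hv
  have hpos : ∀ k : ℕ, (0 : ℝ) < 1 / ((k : ℝ) + 1) := fun k => by positivity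
  exact ⟨_, hpos, tendsto_one_div_add_atTop_nhds_zero_nat,
    hv _ hpos tendsto_one_div_add_atTop_nhds_zero_nat⟩

theorem directionalNormalCone_subset (S : Set E) (x d : E) :
    directionalNormalCone S x d ⊆ limitingNormalCone S x := by
  rintro v ⟨t, -, ht, e, w, he, hw, h⟩
  refine ⟨fun k => x + t k • e k, w, fun k => (h k).1, ?_, hw, h⟩
  simpa using tendsto_const_nhds.add (ht.smul he)

theorem normalCones_eq {S K : Set E} {x d : E} (h₁ : limitingNormalCone S x ⊆ K)
    (h₂ : K ⊆ innerDirectionalNormalCone S x d) :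
    innerDirectionalNormalCone S x d = directionalNormalCone S x d ∧
      directionalNormalCone S x d = limitingNormalCone S x := by
  have a := innerDirectionalNormalCone_subset S x d
  have b := directionalNormalCone_subset S x d
  have c := h₁.trans h₂
  exact ⟨a.antisymm (b.trans c), b.antisymm (c.trans a)⟩

/-- A curve in `S` with right derivative `d` together with regular normals along it. -/
theorem mem_innerDirectionalNormalCone_of_curve {S : Set E} {x d v : E} {e w : ℝ → E}
    (hv : v ∈ frechetNormalCone S x) (he : Tendsto e (𝓝 0) (𝓝 d))
    (hw : Tendsto w (𝓝 0) (𝓝 v))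
    (h : ∀ᶠ t in 𝓝 (0 : ℝ), w t ∈ frechetNormalCone S (x + t • e t)) :
    v ∈ innerDirectionalNormalCone S x d := by
  classical
  intro t _ ht
  have hev : ∀ᶠ k in atTop, w (t k) ∈ frechetNormalCone S (x + t k • e (t k)) := ht.eventually h
  -- Membership is required for every `k`, not only eventually. At the remaining indices the
  -- direction `0` stays at `x`, where `v` itself is normal.
  refine ⟨fun k => if w (t k) ∈ frechetNormalCone S (x + t k • e (t k)) then e (t k) else 0,
    fun k => if w (t k) ∈ frechetNormalCone S (x + t k • e (t k)) then w (t k) else v,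
    (he.comp ht).congr' ?_, (hw.comp ht).congr' ?_, fun k => ?_⟩
  · filter_upwards [hev] with k hk
    simp [hk]
  · filter_upwards [hev] with k hk
    simp [hk]
  · by_cases hk : w (t k) ∈ frechetNormalCone S (x + t k • e (t k))
    · simp [hk]
    · simpa [hk] using hv

end Cones

/-! ### Matrices of bounded rank near a matrix of maximal rank -/

section Factorization

open Matrix

variable {n m : ℕ}

/-- Such a `G` makes `X * G` a projection onto the range of `X` and `1 - G * X` a projection onto
its kernel. -/
theorem exists_mul_mul_self_eq (X : Matrix (Fin n) (Fin m) ℝ) :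
    ∃ G : Matrix (Fin m) (Fin n) ℝ, X * G * X = X := by
  obtain ⟨s, hs⟩ := LinearMap.exists_rightInverse_of_surjective (Matrix.toLin' X).rangeRestrict
    (LinearMap.range_rangeRestrict _)
  obtain ⟨g, hg⟩ := LinearMap.exists_extend s
  refine ⟨LinearMap.toMatrix' g, Matrix.toLin'.injective ?_⟩
  refine LinearMap.ext fun u => ?_
  have h1 : g (Matrix.toLin' X u) = s ((Matrix.toLin' X).rangeRestrict u) :=
    LinearMap.congr_fun hg ((Matrix.toLin' X).rangeRestrict u)
  have h2 := congrArg Subtype.val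
    (LinearMap.congr_fun hs ((Matrix.toLin' X).rangeRestrict u))
  rw [Matrix.toLin'_mul, Matrix.toLin'_mul, Matrix.toLin'_toMatrix']
  simp only [LinearMap.comp_apply, h1]
  exact h2

/-- With `P = 1 + (Y - X) G` one gets `P X = Y G X`, whose range lies in that of `Y`; the rank bound
forces equality. Hence `P⁻¹ Y` maps into the range of `X`, is fixed by `X G`, and can be absorbed
into a right factor. -/
theorem eq_mul_mul_of_rank_le {X Y : Matrix (Fin n) (Fin m) ℝ} {G : Matrix (Fin m) (Fin n) ℝ}
    (hG : X * G * X = X) (hr : Y.rank ≤ X.rank) (hP : IsUnit (1 + (Y - X) * G).det) :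
    Y = (1 + (Y - X) * G) * X * (1 + G * ((1 + (Y - X) * G)⁻¹ * Y - X)) := by
  set P := 1 + (Y - X) * G with hPdef
  have hPX : P * X = Y * (G * X) := by
    rw [hPdef, Matrix.add_mul, Matrix.one_mul, Matrix.sub_mul, Matrix.sub_mul, hG,
      Matrix.mul_assoc]
    abel
  have hle : LinearMap.range (P * X).mulVecLin ≤ LinearMap.range Y.mulVecLin := by
    rw [hPX, Matrix.mulVecLin_mul]
    exact LinearMap.range_comp_le_range _ _
  have heq : LinearMap.range (P * X).mulVecLin = LinearMap.range Y.mulVecLin := by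
    refine Submodule.eq_of_le_of_finrank_le hle ?_
    change Y.rank ≤ (P * X).rank
    rwa [Matrix.rank_mul_eq_right_of_isUnit_det _ _ hP]
  have hrange : X * G * (P⁻¹ * Y) = P⁻¹ * Y := by
    refine Matrix.toLin'.injective (LinearMap.ext fun u => ?_)
    have hu : Y.mulVecLin u ∈ LinearMap.range (P * X).mulVecLin := heq ▸ ⟨u, rfl⟩
    obtain ⟨z, hz⟩ := hu
    have hz' : Y *ᵥ u = P *ᵥ (X *ᵥ z) := by
      rw [Matrix.mulVec_mulVec]
      exact hz.symm
    have h1 : (P⁻¹ * Y) *ᵥ u = X *ᵥ z := by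
      rw [← Matrix.mulVec_mulVec, hz', Matrix.mulVec_mulVec, Matrix.nonsing_inv_mul _ hP,
        Matrix.one_mulVec]
    rw [Matrix.toLin'_apply, Matrix.toLin'_apply, ← Matrix.mulVec_mulVec, h1,
      Matrix.mulVec_mulVec, hG]
  have hXQ : X * (1 + G * (P⁻¹ * Y - X)) = P⁻¹ * Y := by
    rw [Matrix.mul_add, Matrix.mul_one, ← Matrix.mul_assoc, Matrix.mul_sub, hrange, hG]
    abel
  rw [Matrix.mul_assoc, hXQ, Matrix.mul_nonsing_inv_cancel_left _ _ hP]

theorem tendsto_matrix_mul {k : ℕ} {ι : Type*} {l : Filter ι} {A : ι → Matrix (Fin n) (Fin m) ℝ}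
    {B : ι → Matrix (Fin m) (Fin k) ℝ} {A₀ : Matrix (Fin n) (Fin m) ℝ}
    {B₀ : Matrix (Fin m) (Fin k) ℝ} (hA : Tendsto A l (𝓝 A₀)) (hB : Tendsto B l (𝓝 B₀)) :
    Tendsto (fun i => A i * B i) l (𝓝 (A₀ * B₀)) := by
  have h : Tendsto (fun i => ‖A i‖ * ‖B i - B₀‖ + ‖A i - A₀‖ * ‖B₀‖) l (𝓝 0) := by
    simpa using (hA.norm.mul (hB.sub_const B₀).norm).add
      ((hA.sub_const A₀).norm.mul_const ‖B₀‖)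
  refine tendsto_iff_norm_sub_tendsto_zero.2
    (squeeze_zero (fun _ => norm_nonneg _) (fun i => ?_) h)
  have e : A i * B i - A₀ * B₀ = A i * (B i - B₀) + (A i - A₀) * B₀ := by
    rw [Matrix.mul_sub, Matrix.sub_mul]
    abel
  rw [e]
  exact (norm_add_le _ _).trans
    (add_le_add (Matrix.frobenius_norm_mul _ _) (Matrix.frobenius_norm_mul _ _))

theorem tendsto_inv_one {ι : Type*} {l : Filter ι} {P : ι → Matrix (Fin n) (Fin n) ℝ}
    (hP : Tendsto P l (𝓝 1)) : Tendsto (fun i => (P i)⁻¹) l (𝓝 1) := by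
  have hdet : Tendsto (fun i => (P i).det) l (𝓝 1) := by
    have : Continuous fun A : Matrix (Fin n) (Fin n) ℝ => A.det := by fun_prop
    exact (this.tendsto' 1 1 (by simp)).comp hP
  have hadj : Tendsto (fun i => (P i).adjugate) l (𝓝 1) := by
    have : Continuous fun A : Matrix (Fin n) (Fin n) ℝ => A.adjugate := by fun_prop
    exact (this.tendsto' 1 1 (by simp)).comp hP
  have := (hdet.inv₀ one_ne_zero).smul hadj
  simp only [inv_one, one_smul] at this
  refine this.congr fun i => ?_
  rw [Matrix.inv_def, Ring.inverse_eq_inv']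

theorem eventually_isUnit_det {ι : Type*} {l : Filter ι} {P : ι → Matrix (Fin n) (Fin n) ℝ}
    (hP : Tendsto P l (𝓝 1)) : ∀ᶠ i in l, IsUnit (P i).det := by
  have : Continuous fun A : Matrix (Fin n) (Fin n) ℝ => A.det := by fun_prop
  have h := (this.tendsto 1).comp hP
  rw [Matrix.det_one] at h
  filter_upwards [h.eventually_ne one_ne_zero] with i hi
  exact isUnit_iff_ne_zero.2 hi

/-- Near `X`, every matrix `Y` with `rank Y ≤ rank X` is obtained from `X` by multiplications with
matrices close to the identity. -/
theorem exists_local_factorization (X : Matrix (Fin n) (Fin m) ℝ) :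
    ∃ (G : Matrix (Fin m) (Fin n) ℝ) (ψ : Matrix (Fin n) (Fin m) ℝ → Matrix (Fin m) (Fin m) ℝ),
      X * G * X = X ∧ Tendsto ψ (𝓝 X) (𝓝 0) ∧
      ∀ᶠ Y in 𝓝 X, Y.rank ≤ X.rank → Y = (1 + (Y - X) * G) * X * (1 + ψ Y) := by
  obtain ⟨G, hG⟩ := exists_mul_mul_self_eq X
  have hP : Tendsto (fun Y => 1 + (Y - X) * G) (𝓝 X) (𝓝 1) := by
    refine Continuous.tendsto' ?_ _ _ (by simp)
    fun_prop
  refine ⟨G, fun Y => G * ((1 + (Y - X) * G)⁻¹ * Y - X), hG, ?_, ?_⟩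
  · have h := tendsto_matrix_mul (tendsto_const_nhds (x := G))
      ((tendsto_matrix_mul (tendsto_inv_one hP) tendsto_id).sub_const X)
    rw [Matrix.one_mul, sub_self, Matrix.mul_zero] at h
    exact h
  · filter_upwards [eventually_isUnit_det hP] with Y hY hr
    exact eq_mul_mul_of_rank_le hG hr hY

/-! ### Tangents and regular normals of the rank constraint. -/

theorem inner_eq_trace (V W : Matrix (Fin n) (Fin m) ℝ) :
    inner ℝ V W = (Vᵀ * W).trace := rfl

/-- Compressing by `1 - X G` on the left and `1 - G X` on the right kills every term of the
factorization except `t w G X ψ`, which is `o(t)`. So the compression of `H` vanishes. -/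
theorem exists_of_mem_bouligandTangentCone_rankSet {r : ℕ} {X H : Matrix (Fin n) (Fin m) ℝ}
    (hX : X.rank = r) (hH : H ∈ bouligandTangentCone (rankSet n m r) X) :
    ∃ (A : Matrix (Fin n) (Fin n) ℝ) (B : Matrix (Fin m) (Fin m) ℝ), H = A * X + X * B := by
  obtain ⟨G, ψ, hG, hψ, hfac⟩ := exists_local_factorization X
  obtain ⟨w, t, hw, htpos, ht, hmem⟩ := hH
  have hY : Tendsto (fun k => X + t k • w k) atTop (𝓝 X) := by
    have h := (ht.smul hw).const_add X
    rw [zero_smul, add_zero] at h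
    exact h
  have hl : Tendsto (fun k => (1 - X * G) * w k * (1 - G * X)) atTop
      (𝓝 ((1 - X * G) * H * (1 - G * X))) := by
    have hc : Continuous fun W : Matrix (Fin n) (Fin m) ℝ => (1 - X * G) * W * (1 - G * X) := by
      fun_prop
    exact (hc.tendsto H).comp hw
  have hr : Tendsto (fun k => (1 - X * G) * (w k * G * X * ψ (X + t k • w k)) * (1 - G * X)) atTop
      (𝓝 0) := by
    have h1 := tendsto_matrix_mul (tendsto_matrix_mul (tendsto_matrix_mul hw
      (tendsto_const_nhds (x := G))) (tendsto_const_nhds (x := X))) (hψ.comp hY)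
    have h2 := tendsto_matrix_mul (tendsto_matrix_mul (tendsto_const_nhds (x := 1 - X * G)) h1)
      (tendsto_const_nhds (x := 1 - G * X))
    rw [Matrix.mul_zero, Matrix.mul_zero, Matrix.zero_mul] at h2
    exact h2
  have hL : (1 - X * G) * X = 0 := by rw [Matrix.sub_mul, hG, Matrix.one_mul, sub_self]
  have hR : X * (1 - G * X) = 0 := by
    rw [Matrix.mul_sub, ← Matrix.mul_assoc, hG, Matrix.mul_one, sub_self]
  have hzero : (1 - X * G) * H * (1 - G * X) = 0 := by
    refine tendsto_nhds_unique hl (hr.congr' ?_)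
    filter_upwards [hY.eventually hfac] with k hk
    have hk' := hk ((hmem k).trans_eq hX.symm)
    rw [add_sub_cancel_left] at hk'
    have h1 : (1 - X * G) * (X + t k • w k) * (1 - G * X)
        = t k • ((1 - X * G) * w k * (1 - G * X)) := by
      rw [Matrix.mul_add, hL, zero_add, Matrix.mul_smul, Matrix.smul_mul]
    have h2 : (1 - X * G) * ((1 + t k • w k * G) * X * (1 + ψ (X + t k • w k))) * (1 - G * X)
        = t k • ((1 - X * G) * (w k * G * X * ψ (X + t k • w k)) * (1 - G * X)) := by
      generalize ψ (X + t k • w k) = Z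
      have e : (1 + t k • w k * G) * X * (1 + Z)
          = X + X * Z + t k • (w k * G * X) + t k • (w k * G * X * Z) := by
        simp only [Matrix.add_mul, Matrix.mul_add, Matrix.one_mul, Matrix.mul_one,
          Matrix.smul_mul]
        abel
      have e2 : t k • (w k * G * X) * (1 - G * X) = 0 := by
        rw [Matrix.smul_mul, Matrix.mul_assoc, hR, Matrix.mul_zero, smul_zero]
      rw [e, Matrix.mul_add, Matrix.mul_add, Matrix.mul_add, hL, ← Matrix.mul_assoc _ X Z, hL,
        Matrix.zero_mul, add_zero, zero_add, Matrix.add_mul, Matrix.mul_assoc _ (t k • _), e2,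
        Matrix.mul_zero, zero_add, Matrix.mul_smul, Matrix.smul_mul]
    rw [← hk', h1] at h2
    exact (smul_right_injective _ (htpos k).ne' h2).symm
  -- The witnesses are read off by expanding `(1 - X G) H (1 - G X) = 0`.
  refine ⟨H * G, G * (H - H * G * X), ?_⟩
  have e : (1 - X * G) * H * (1 - G * X) = H - (H * G * X + X * (G * (H - H * G * X))) := by
    simp only [Matrix.sub_mul, Matrix.mul_sub, Matrix.one_mul, Matrix.mul_one, Matrix.mul_assoc]
    abel
  rw [e] at hzero
  exact sub_eq_zero.1 hzero

/-- The factorization splits `Y - X` into `X ψ`, `(Y - X) G X` and `(Y - X) G X ψ`. The first two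
are orthogonal to `V`; the last is `o(‖Y - X‖)` because `ψ → 0`. -/
theorem mem_frechetNormalCone_rankSet {r : ℕ} {X V : Matrix (Fin n) (Fin m) ℝ}
    (hX : X.rank = r) (h₁ : Vᵀ * X = 0) (h₂ : X * Vᵀ = 0) :
    V ∈ frechetNormalCone (rankSet n m r) X := by
  refine mem_frechetNormalCone_iff.2 ⟨hX.le, fun ε hε => ?_⟩
  obtain ⟨G, ψ, hG, hψ, hfac⟩ := exists_local_factorization X
  have hsmall : Tendsto (fun Y => ‖V‖ * ‖G * X * ψ Y‖) (𝓝 X) (𝓝 0) := by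
    have hc : Continuous fun Z : Matrix (Fin m) (Fin m) ℝ => ‖V‖ * ‖G * X * Z‖ := by fun_prop
    exact (hc.tendsto' 0 0 (by simp)).comp hψ
  rw [eventually_nhdsWithin_iff]
  filter_upwards [hfac, hsmall.eventually (gt_mem_nhds hε)] with Y hY hs hYr
  have hY' := hY (le_of_le_of_eq hYr hX.symm)
  have e : Y - X = X * ψ Y + (Y - X) * G * X + (Y - X) * (G * X * ψ Y) := by
    conv_lhs => rw [hY']
    simp only [Matrix.add_mul, Matrix.mul_add, Matrix.one_mul, Matrix.mul_one, Matrix.mul_assoc]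
    abel
  have t1 : (Vᵀ * (X * ψ Y)).trace = 0 := by
    rw [← Matrix.mul_assoc, h₁, Matrix.zero_mul, Matrix.trace_zero]
  have t2 : (Vᵀ * ((Y - X) * G * X)).trace = 0 := by
    rw [← Matrix.mul_assoc, Matrix.trace_mul_comm, ← Matrix.mul_assoc, h₂, Matrix.zero_mul,
      Matrix.trace_zero]
  calc inner ℝ V (Y - X) = inner ℝ V ((Y - X) * (G * X * ψ Y)) := by
        conv_lhs => rw [e]
        simp only [inner_eq_trace]
        rw [Matrix.mul_add, Matrix.mul_add, Matrix.trace_add, Matrix.trace_add, t1, t2, zero_add,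
          zero_add]
    _ ≤ ‖V‖ * ‖(Y - X) * (G * X * ψ Y)‖ := real_inner_le_norm _ _
    _ ≤ ‖V‖ * (‖Y - X‖ * ‖G * X * ψ Y‖) := by
        gcongr
        exact Matrix.frobenius_norm_mul _ _
    _ = ‖V‖ * ‖G * X * ψ Y‖ * ‖Y - X‖ := by ring
    _ ≤ ε * ‖Y - X‖ := by gcongr

theorem mul_eq_zero_of_mem_frechetNormalCone_rankSet {r : ℕ} {X V : Matrix (Fin n) (Fin m) ℝ}
    (hV : V ∈ frechetNormalCone (rankSet n m r) X) : Vᵀ * X = 0 ∧ X * Vᵀ = 0 := by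
  have key : ∀ (A : Matrix (Fin n) (Fin n) ℝ) (B : Matrix (Fin m) (Fin m) ℝ),
      inner ℝ V (A * X + X * B) ≤ 0 := by
    intro A B
    refine inner_nonpos_of_mem_frechetNormalCone (w := A * X * B) hV fun t => ?_
    have e : X + (t • (A * X + X * B) + t ^ 2 • (A * X * B)) = (1 + t • A) * X * (1 + t • B) := by
      simp only [Matrix.add_mul, Matrix.mul_add, Matrix.one_mul, Matrix.mul_one, Matrix.smul_mul,
        Matrix.mul_smul, smul_add, smul_smul, sq]
      abel
    rw [e]
    exact (Matrix.rank_mul_le_left _ _).trans ((Matrix.rank_mul_le_right _ _).trans hV.1)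
  constructor
  · have h := key 0 (Xᵀ * V)
    rw [Matrix.zero_mul, zero_add, inner_eq_trace] at h
    have e : (Vᵀ * (X * (Xᵀ * V))).trace = inner ℝ (Xᵀ * V) (Xᵀ * V) := by
      rw [inner_eq_trace, Matrix.transpose_mul, Matrix.transpose_transpose]
      simp only [Matrix.mul_assoc]
    rw [e] at h
    have h0 : Xᵀ * V = 0 := real_inner_self_nonpos.1 h
    simpa using congrArg Matrix.transpose h0
  · have h := key (V * Xᵀ) 0
    rw [Matrix.mul_zero, add_zero, inner_eq_trace] at h
    have e : (Vᵀ * (V * Xᵀ * X)).trace = inner ℝ (V * Xᵀ) (V * Xᵀ) := by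
      rw [inner_eq_trace, ← Matrix.mul_assoc, Matrix.trace_mul_comm, Matrix.transpose_mul,
        Matrix.transpose_transpose]
      simp only [Matrix.mul_assoc]
    rw [e] at h
    have h0 : V * Xᵀ = 0 := real_inner_self_nonpos.1 h
    simpa using congrArg Matrix.transpose h0

end Factorization

section RankCones

open Matrix

variable {n m : ℕ}

theorem tendsto_matrix_transpose {ι : Type*} {l : Filter ι} {A : ι → Matrix (Fin n) (Fin m) ℝ}
    {A₀ : Matrix (Fin n) (Fin m) ℝ} (hA : Tendsto A l (𝓝 A₀)) :
    Tendsto (fun i => (A i)ᵀ) l (𝓝 A₀ᵀ) := by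
  have hc : Continuous fun A : Matrix (Fin n) (Fin m) ℝ => Aᵀ := by fun_prop
  exact (hc.tendsto A₀).comp hA

theorem tendsto_one_add_smul (A : Matrix (Fin n) (Fin n) ℝ) :
    Tendsto (fun t : ℝ => 1 + t • A) (𝓝 0) (𝓝 1) :=
  Continuous.tendsto' (by fun_prop) _ _ (by simp)

/-! ### The rank constraint in the space of all matrices -/

theorem rankSet_normalCones_eq {r : ℕ} {X H : Matrix (Fin n) (Fin m) ℝ} (hX : X.rank = r)
    (hH : H ∈ bouligandTangentCone (rankSet n m r) X) :
    innerDirectionalNormalCone (rankSet n m r) X H = directionalNormalCone (rankSet n m r) X H ∧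
      directionalNormalCone (rankSet n m r) X H = limitingNormalCone (rankSet n m r) X := by
  refine normalCones_eq (K := {V | Vᵀ * X = 0 ∧ X * Vᵀ = 0}) ?_ ?_
  · rintro V ⟨y, w, -, hy, hw, h⟩
    have h0 := fun k => mul_eq_zero_of_mem_frechetNormalCone_rankSet (h k)
    have hwT := tendsto_matrix_transpose hw
    constructor
    · refine tendsto_nhds_unique (tendsto_matrix_mul hwT hy) ?_
      simp only [(h0 _).1, tendsto_const_nhds]
    · refine tendsto_nhds_unique (tendsto_matrix_mul hy hwT) ?_
      simp only [(h0 _).2, tendsto_const_nhds]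
  · rintro V ⟨h₁, h₂⟩
    obtain ⟨A, B, rfl⟩ := exists_of_mem_bouligandTangentCone_rankSet hX hH
    have hP := tendsto_one_add_smul A
    have hQ := tendsto_one_add_smul B
    -- The inverse transposes cancel the outer factors of `(1 + t A) X (1 + t B)`, so both products
    -- with the transported `V` still vanish.
    refine mem_innerDirectionalNormalCone_of_curve (e := fun t => A * X + X * B + t • (A * X * B))
      (w := fun t => ((1 + t • A)⁻¹)ᵀ * V * ((1 + t • B)⁻¹)ᵀ)
      (mem_frechetNormalCone_rankSet hX h₁ h₂) ?_ ?_ ?_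
    · exact Continuous.tendsto' (by fun_prop) _ _ (by simp)
    · have h := tendsto_matrix_mul (tendsto_matrix_mul
        (tendsto_matrix_transpose (tendsto_inv_one hP)) (tendsto_const_nhds (x := V)))
        (tendsto_matrix_transpose (tendsto_inv_one hQ))
      rwa [Matrix.transpose_one, Matrix.transpose_one, Matrix.one_mul, Matrix.mul_one] at h
    · filter_upwards [eventually_isUnit_det hP, eventually_isUnit_det hQ] with t hPt hQt
      have e : X + t • (A * X + X * B + t • (A * X * B)) = (1 + t • A) * X * (1 + t • B) := by
        simp only [Matrix.add_mul, Matrix.mul_add, Matrix.one_mul, Matrix.mul_one,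
          Matrix.smul_mul, Matrix.mul_smul, smul_add, smul_smul]
        abel
      rw [e]
      refine mem_frechetNormalCone_rankSet ?_ ?_ ?_
      · rw [Matrix.rank_mul_eq_left_of_isUnit_det _ _ hQt,
          Matrix.rank_mul_eq_right_of_isUnit_det _ _ hPt, hX]
      · rw [Matrix.transpose_mul, Matrix.transpose_mul, Matrix.transpose_transpose,
          Matrix.transpose_transpose, Matrix.mul_assoc, Matrix.mul_assoc, Matrix.mul_assoc,
          Matrix.nonsing_inv_mul_cancel_left _ _ hPt, ← Matrix.mul_assoc Vᵀ, h₁,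
          Matrix.zero_mul, Matrix.mul_zero]
      · rw [Matrix.transpose_mul, Matrix.transpose_mul, Matrix.transpose_transpose,
          Matrix.transpose_transpose, Matrix.mul_assoc,
          Matrix.mul_nonsing_inv_cancel_left _ _ hQt, ← Matrix.mul_assoc, Matrix.mul_assoc _ X,
          h₂, Matrix.mul_zero, Matrix.zero_mul]

/-! ### Rank constraints in the space of symmetric matrices -/

theorem symMatrix_transpose (Z : symMatrix n) : Z.1ᵀ = Z.1 := Z.2

theorem tendsto_symMatrix_val {ι : Type*} {l : Filter ι} {A : ι → symMatrix n} {A₀ : symMatrix n}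
    (hA : Tendsto A l (𝓝 A₀)) : Tendsto (fun i => (A i).1) l (𝓝 A₀.1) :=
  tendsto_subtype_rng.1 hA

/-- The congruence transformation `Z ↦ P Z Pᵀ` of symmetric matrices. -/
def symCongruence (P : Matrix (Fin n) (Fin n) ℝ) (Z : symMatrix n) : symMatrix n :=
  ⟨P * Z.1 * Pᵀ, by
    change (_ * _ * _)ᵀ = _
    rw [Matrix.transpose_mul, Matrix.transpose_mul, Matrix.transpose_transpose,
      symMatrix_transpose, Matrix.mul_assoc]⟩

theorem rank_symCongruence_le (P : Matrix (Fin n) (Fin n) ℝ) (Z : symMatrix n) :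
    (symCongruence P Z).1.rank ≤ Z.1.rank :=
  (Matrix.rank_mul_le_left _ _).trans (Matrix.rank_mul_le_right _ _)

theorem rank_symCongruence {P : Matrix (Fin n) (Fin n) ℝ} (hP : IsUnit P.det) (Z : symMatrix n) :
    (symCongruence P Z).1.rank = Z.1.rank := by
  change (P * Z.1 * Pᵀ).rank = _
  rw [Matrix.rank_mul_eq_left_of_isUnit_det _ _ (by rwa [Matrix.det_transpose]),
    Matrix.rank_mul_eq_right_of_isUnit_det _ _ hP]

/-- The derivative at `0` of `t ↦ (1 + t A) X (1 + t A)ᵀ`. -/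
def symLieAction (A : Matrix (Fin n) (Fin n) ℝ) (X : symMatrix n) : symMatrix n :=
  ⟨A * X.1 + X.1 * Aᵀ, by
    change (_ + _)ᵀ = _
    rw [Matrix.transpose_add, Matrix.transpose_mul, Matrix.transpose_mul,
      Matrix.transpose_transpose, symMatrix_transpose, add_comm]⟩

theorem symCongruence_one_add_smul (A : Matrix (Fin n) (Fin n) ℝ) (X : symMatrix n) (t : ℝ) :
    symCongruence (1 + t • A) X = X + t • (symLieAction A X + t • symCongruence A X) := by
  refine Subtype.ext ?_
  change (1 + t • A) * X.1 * (1 + t • A)ᵀ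
    = X.1 + t • ((A * X.1 + X.1 * Aᵀ) + t • (A * X.1 * Aᵀ))
  simp only [Matrix.transpose_add, Matrix.transpose_smul, Matrix.transpose_one, Matrix.add_mul,
    Matrix.mul_add, Matrix.one_mul, Matrix.mul_one, Matrix.smul_mul, Matrix.mul_smul, smul_add,
    smul_smul]
  abel

/-- Passing to a smaller set only weakens the normality inequality, so normals are inherited from
`rankSet`. By symmetry one equation implies the other. -/
theorem mem_frechetNormalCone_of_subset_symRankSet {r : ℕ} {S : Set (symMatrix n)}
    {X V : symMatrix n} (hS : S ⊆ symRankSet n r) (hXS : X ∈ S) (hX : X.1.rank = r)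
    (hV : V.1 * X.1 = 0) : V ∈ frechetNormalCone S X := by
  have h₂ : X.1 * V.1 = 0 := by
    simpa [symMatrix_transpose] using congrArg Matrix.transpose hV
  have h := mem_frechetNormalCone_rankSet hX (V := V.1) (by rwa [symMatrix_transpose])
    (by rwa [symMatrix_transpose])
  refine mem_frechetNormalCone_iff.2 ⟨hXS, fun ε hε => ?_⟩
  have hval : Tendsto (Subtype.val : symMatrix n → Matrix (Fin n) (Fin n) ℝ) (𝓝[S] X)
      (𝓝[rankSet n n r] X.1) :=
    continuous_subtype_val.continuousWithinAt.tendsto_nhdsWithin fun _ hY => hS hY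
  exact hval.eventually ((mem_frechetNormalCone_iff.1 h).2 ε hε)

/-- Testing with the velocity of the congruence curve for `A = V X` gives `2 ‖V X‖² ≤ 0`. -/
theorem mul_eq_zero_of_mem_frechetNormalCone {S : Set (symMatrix n)}
    {X V : symMatrix n} (hS : ∀ P, ∀ Z ∈ S, symCongruence P Z ∈ S)
    (hV : V ∈ frechetNormalCone S X) : V.1 * X.1 = 0 := by
  have h : inner ℝ V (symLieAction (V.1 * X.1) X) ≤ 0 := by
    refine inner_nonpos_of_mem_frechetNormalCone (w := symCongruence (V.1 * X.1) X) hV fun t => ?_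
    have := symCongruence_one_add_smul (V.1 * X.1) X t
    rw [smul_add, smul_smul, ← sq] at this
    rw [← this]
    exact hS _ _ hV.1
  have e : inner ℝ V (symLieAction (V.1 * X.1) X) = 2 * inner ℝ (V.1 * X.1) (V.1 * X.1) := by
    change (V.1ᵀ * (V.1 * X.1 * X.1 + X.1 * (V.1 * X.1)ᵀ)).trace
      = 2 * ((V.1 * X.1)ᵀ * (V.1 * X.1)).trace
    have e1 : (V.1 * (V.1 * X.1 * X.1)).trace = (X.1 * V.1 * (V.1 * X.1)).trace := by
      rw [← Matrix.mul_assoc, Matrix.trace_mul_comm, ← Matrix.mul_assoc]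
    have e2 : (V.1 * (X.1 * (X.1 * V.1))).trace = (X.1 * V.1 * (V.1 * X.1)).trace := by
      rw [← Matrix.mul_assoc, Matrix.trace_mul_comm]
    rw [Matrix.transpose_mul, symMatrix_transpose, symMatrix_transpose, Matrix.mul_add,
      Matrix.trace_add, e1, e2, two_mul]
  rw [e] at h
  exact real_inner_self_nonpos.1 (by linarith)

theorem exists_of_mem_bouligandTangentCone_of_subset_symRankSet {r : ℕ} {S : Set (symMatrix n)}
    {X H : symMatrix n} (hS : S ⊆ symRankSet n r) (hX : X.1.rank = r)
    (hH : H ∈ bouligandTangentCone S X) :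
    ∃ A : Matrix (Fin n) (Fin n) ℝ, H = symLieAction A X := by
  have h : H.1 ∈ bouligandTangentCone (rankSet n n r) X.1 := by
    obtain ⟨w, t, hw, htpos, ht, hmem⟩ := hH
    refine ⟨fun k => (w k).1, t, tendsto_symMatrix_val hw, htpos, ht, fun k => ?_⟩
    have hk : (X + t k • w k).1.rank ≤ r := hS (hmem k)
    exact hk
  obtain ⟨A, B, hAB⟩ := exists_of_mem_bouligandTangentCone_rankSet hX h
  -- Since `H` is symmetric, it is the average of `A X + X B` and its transpose.
  refine ⟨(2⁻¹ : ℝ) • (A + Bᵀ), Subtype.ext ?_⟩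
  have hT : H.1 = X.1 * Aᵀ + Bᵀ * X.1 := by
    have := congrArg Matrix.transpose hAB
    rwa [Matrix.transpose_add, Matrix.transpose_mul, Matrix.transpose_mul, symMatrix_transpose,
      symMatrix_transpose] at this
  change H.1 = ((2⁻¹ : ℝ) • (A + Bᵀ)) * X.1 + X.1 * ((2⁻¹ : ℝ) • (A + Bᵀ))ᵀ
  have e : H.1 = (2⁻¹ : ℝ) • (H.1 + H.1) := by
    rw [← two_smul ℝ H.1, smul_smul]
    norm_num
  rw [e]
  nth_rewrite 1 [hAB]
  rw [hT, Matrix.transpose_smul, Matrix.transpose_add, Matrix.transpose_transpose,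
    Matrix.smul_mul, Matrix.mul_smul, ← smul_add, Matrix.add_mul, Matrix.mul_add]
  congr 1
  abel

/-- Only the rank bound and congruence invariance of `S` matter, so `symRankSet` and `psdRankSet`
are treated together and positivity leaves no trace in the cone. -/
theorem normalCones_eq_of_subset_symRankSet {r : ℕ} {S : Set (symMatrix n)}
    {X H : symMatrix n} (hS : S ⊆ symRankSet n r) (hcongr : ∀ P, ∀ Z ∈ S, symCongruence P Z ∈ S)
    (hXS : X ∈ S) (hX : X.1.rank = r) (hH : H ∈ bouligandTangentCone S X) :
    innerDirectionalNormalCone S X H = directionalNormalCone S X H ∧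
      directionalNormalCone S X H = limitingNormalCone S X := by
  refine normalCones_eq (K := {V | V.1 * X.1 = 0}) ?_ ?_
  · rintro V ⟨y, w, -, hy, hw, h⟩
    have h0 := fun k => mul_eq_zero_of_mem_frechetNormalCone hcongr (h k)
    have hl := tendsto_matrix_mul (tendsto_symMatrix_val hw)
      (tendsto_symMatrix_val hy)
    refine tendsto_nhds_unique hl ?_
    simp only [h0, tendsto_const_nhds]
  · intro V hV
    have hV : V.1 * X.1 = 0 := hV
    obtain ⟨A, rfl⟩ := exists_of_mem_bouligandTangentCone_of_subset_symRankSet hS hX hH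
    have hP := tendsto_one_add_smul A
    refine mem_innerDirectionalNormalCone_of_curve
      (e := fun t => symLieAction A X + t • symCongruence A X)
      (w := fun t => symCongruence ((1 + t • A)⁻¹)ᵀ V)
      (mem_frechetNormalCone_of_subset_symRankSet hS hXS hX hV) ?_ ?_ ?_
    · exact Continuous.tendsto' (by fun_prop) _ _ (by simp)
    · have hi := tendsto_matrix_transpose (tendsto_inv_one hP)
      have h := tendsto_matrix_mul (tendsto_matrix_mul hi (tendsto_const_nhds (x := V.1)))
        (tendsto_matrix_transpose hi)
      rw [Matrix.transpose_one, Matrix.transpose_one, Matrix.one_mul, Matrix.mul_one] at h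
      exact tendsto_subtype_rng.2 h
    · filter_upwards [eventually_isUnit_det hP] with t hPt
      rw [← symCongruence_one_add_smul]
      refine mem_frechetNormalCone_of_subset_symRankSet hS (hcongr _ _ hXS) ?_ ?_
      · rw [rank_symCongruence hPt, hX]
      · change ((1 + t • A)⁻¹)ᵀ * V.1 * ((1 + t • A)⁻¹)ᵀᵀ
          * ((1 + t • A) * X.1 * (1 + t • A)ᵀ) = 0
        rw [Matrix.transpose_transpose, Matrix.mul_assoc, Matrix.mul_assoc (1 + t • A),
          Matrix.nonsing_inv_mul_cancel_left _ _ hPt, Matrix.mul_assoc, ← Matrix.mul_assoc V.1,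
          hV, Matrix.zero_mul, Matrix.mul_zero]

theorem symCongruence_mem_psdRankSet {r : ℕ} (P : Matrix (Fin n) (Fin n) ℝ) {Z : symMatrix n}
    (hZ : Z ∈ psdRankSet n r) : symCongruence P Z ∈ psdRankSet n r := by
  refine ⟨?_, (rank_symCongruence_le P Z).trans hZ.2⟩
  have h := hZ.1.mul_mul_conjTranspose_same P
  rwa [Matrix.conjTranspose_eq_transpose_of_trivial] at h

end RankCones

theorem proposition2p1 (n r : ℕ) (hr : 1 ≤ r) (hrn : r ≤ n) :
    (∀ X ∈ psdRankSet n r, X.1.rank = r →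
      ∀ H ∈ bouligandTangentCone (psdRankSet n r) X,
        innerDirectionalNormalCone (psdRankSet n r) X H
            = directionalNormalCone (psdRankSet n r) X H ∧
          directionalNormalCone (psdRankSet n r) X H
            = limitingNormalCone (psdRankSet n r) X) ∧
    (∀ m : ℕ, n ≤ m → ∀ X ∈ rankSet n m r, X.rank = r →
      ∀ H ∈ bouligandTangentCone (rankSet n m r) X,
        innerDirectionalNormalCone (rankSet n m r) X H
            = directionalNormalCone (rankSet n m r) X H ∧
          directionalNormalCone (rankSet n m r) X H
            = limitingNormalCone (rankSet n m r) X) ∧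
    (∀ X ∈ symRankSet n r, X.1.rank = r →
      ∀ H ∈ bouligandTangentCone (symRankSet n r) X,
        innerDirectionalNormalCone (symRankSet n r) X H
            = directionalNormalCone (symRankSet n r) X H ∧
          directionalNormalCone (symRankSet n r) X H
            = limitingNormalCone (symRankSet n r) X) := by
  refine ⟨fun X hXS hX H hH => ?_, fun m _ X _ hX H hH => rankSet_normalCones_eq hX hH,
    fun X hXS hX H hH => ?_⟩
  · exact normalCones_eq_of_subset_symRankSet (fun _ hZ => hZ.2)
      (fun P _ hZ => symCongruence_mem_psdRankSet P hZ) hXS hX hH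
  · exact normalCones_eq_of_subset_symRankSet subset_rfl
      (fun P Z hZ => (rank_symCongruence_le P Z).trans hZ) hXS hX hH
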